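/- Let $\mathbb F$ be an algebraically closed field (for instance the algebraic closure of a subfield of $\mathbb C$), let $b\ge 2$ be an integer, and let $M$ be the Mahler operator $y(x)\mapsto y(x^b)$. Let $L=\ell_rM^r+\dots+\ell_1M+\ell_0$ with $\ell_0,\dots,\ell_r\in\mathbb F[x]$, $\ell_0\ell_r\ne 0$ and $\gcd(\ell_0,\dots,\ell_r)=1$, and let $d=\max_k\deg\ell_k$. Set $B_{\mathrm{num}}=2d$, $B_{\mathrm{den}}=2(1-2^{-r})d$ if $b=2$, and $B_{\mathrm{num}}=4d/b^{r-1}$, $B_{\mathrm{den}}=3d/b^{r-1}$ if $b\ge 3$; let $B_\infty=\max(B_{\mathrm{num}},B_{\mathrm{den}})$. Let $z_1,\dots,z_N$ be a basis of the $\mathbb F$-vector space of solutions $y\in\mathbb F[[x]]$ of $Ly=0$, and assume that every Puiseux series solution $y\in\bigcup_{q\ge1}\mathbb F((x^{1/q}))$ of $Ly=0$ lies in $\mathbb F[[x]]$. Put $f=(z_1,\dots,z_N,Mz_1,\dots,Mz_N)$. For $\sigma\in\mathbb N$ let $\mathscr S^{[\sigma]}$ be the $\mathbb F[x]$-module of all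 $w\in\mathbb F[x]^{2N}$ with $\sum_i w_if_i=O(x^\sigma)$, and let $\mathscr S^{[\infty]}$ be the module of all $w$ with $\sum_i w_if_i=0$. For $\sigma\in\mathbb N\cup\{\infty\}$ let $\mathscr T^{[\sigma]}$ be the $\mathbb F$-vector space of those $w\in\mathscr S^{[\sigma]}$ all of whose entries have degree at most $B_\infty$, and let $\rho^{[\sigma]}$ be the rank of the $\mathbb F[x]$-module generated by $\mathscr T^{[\sigma]}$. Let $\sigma\in\mathbb N$ be such that $1\le\rho^{[\sigma]}\le 2N-2$ and $\mathscr T^{[\sigma]}=\mathscr T^{[\infty]}$. Let $(w_1,\dots,w_{2N})$ be a minimal basis of $\mathscr S^{[\sigma]}$, that is, an $\mathbb F[x]$-basis such that for each $i$ the tuple $w_i=(p_1,\dots,p_{2N})$ satisfies $\deg p_j\le\deg p_i$ for $j\le i$ and $\deg p_{j}<\deg p_i$ for $j>i$. Let $W$ be the matrix whose rows are those $w_i$ whose entries all have degree at most $B_\infty$ (there are $\rho^{[\sigma]}$ of them), and let $W_a$ be the matrix with entries in $\mathbb F[a_1,\dots,a_N][x]$ obtained by appending to $W$ the two rows $(a_1,\dots,a_N,0,\dots,0)$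 and $(0,\dots,0,a_1,\dots,a_N)$. Let $\Sigma\subseteq\mathbb F[a_1,\dots,a_N]$ be the set of all coefficients, with respect to the powers of $x$, of the maximal minors (those of order $\rho^{[\sigma]}+2$) of $W_a$. Then the radical of the ideal of $\mathbb F[a_1,\dots,a_N]$ generated by $\Sigma$ is the intersection of a finite set of prime ideals, each of which is generated by homogeneous linear polynomials in $a_1,\dots,a_N$ with coefficients in $\mathbb F$. -/

import Mathlib

open Polynomial

namespace Mahler

noncomputable section

/-! ### Mahler operators acting on power series and on Puiseux series

An operator `L = ℓ_r M ^ r + ⋯ + ℓ_1 M + ℓ_0` of radix `b` over `K[x]` is given by its coefficients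
`ℓ : Fin (r + 1) → K[X]`. -/

/-- The action `y ↦ ∑ k, ℓ_k(x) · M ^ k y` on a commutative ring `A` in which polynomials are
interpreted by `ι` and the Mahler operator by the endomorphism `M`. -/
def opAction {K : Type*} [Field K] {A : Type*} [CommRing A] (ι : K[X] →+* A) (M : A →+* A)
    {r : ℕ} (ℓ : Fin (r + 1) → K[X]) (y : A) : A :=
  ∑ k : Fin (r + 1), ι (ℓ k) * (⇑M)^[(k : ℕ)] y

/-- The Mahler operator `y(x) ↦ y(x ^ b)` on formal power series. -/
def mahlerPS (K : Type*) [Field K] (b : ℕ) (hb : 2 ≤ b) : PowerSeries K →+* PowerSeries K :=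
  (PowerSeries.expand b (by omega) : PowerSeries K →ₐ[K] PowerSeries K).toRingHom

/-- The Mahler operator `y(x) ↦ y(x ^ b)` on Hahn series with rational exponents: the term
`c x ^ e` is mapped to `c x ^ (b e)`. -/
def mahlerHahn (K : Type*) [Field K] (b : ℕ) (hb : 2 ≤ b) : HahnSeries ℚ K →+* HahnSeries ℚ K :=
  HahnSeries.embDomainRingHom (AddMonoidHom.mulLeft (b : ℚ))
    (by
      intro x y h
      have hb' : (b : ℚ) ≠ 0 := by positivity
      simpa [hb'] using h)
    (by
      intro x y
      have hb' : (0 : ℚ) < b := by positivity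
      simp [hb'])

/-- The action of `L` on formal power series. -/
def opPS {K : Type*} [Field K] (b : ℕ) (hb : 2 ≤ b) {r : ℕ} (ℓ : Fin (r + 1) → K[X])
    (y : PowerSeries K) : PowerSeries K :=
  opAction Polynomial.coeToPowerSeries.ringHom (mahlerPS K b hb) ℓ y

/-- The action of `L` on Hahn series with rational exponents. -/
def opHahn {K : Type*} [Field K] (b : ℕ) (hb : 2 ≤ b) {r : ℕ} (ℓ : Fin (r + 1) → K[X])
    (y : HahnSeries ℚ K) : HahnSeries ℚ K :=
  opAction ((HahnSeries.ofPowerSeries ℚ K).comp Polynomial.coeToPowerSeries.ringHom)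
    (mahlerHahn K b hb) ℓ y

/-- The space of formal power series solutions `y ∈ K⟦x⟧` of `L y = 0`. -/
def seriesSolutions {K : Type*} [Field K] (b : ℕ) (hb : 2 ≤ b) {r : ℕ} (ℓ : Fin (r + 1) → K[X]) :
    Submodule K (PowerSeries K) where
  carrier := {y | opPS b hb ℓ y = 0}
  zero_mem' := by
    simp [opPS, opAction, iterate_map_zero]
  add_mem' := by
    intro u v hu hv
    simp only [Set.mem_ofPred_eq, opPS, opAction] at hu hv ⊢
    simp [iterate_map_add, mul_add, Finset.sum_add_distrib] at hu hv ⊢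
    simp [hu, hv]
  smul_mem' := by
    intro c y hy
    have h : ∀ n : ℕ, (⇑(mahlerPS K b hb))^[n] (c • y) = c • (⇑(mahlerPS K b hb))^[n] y := by
      intro n
      induction n with
      | zero => rfl
      | succ n ih =>
        rw [Function.iterate_succ_apply', Function.iterate_succ_apply', ih]
        exact map_smul (PowerSeries.expand b (by omega) : PowerSeries K →ₐ[K] PowerSeries K) c _
    simp only [Set.mem_ofPred_eq, opPS, opAction] at hy ⊢
    simp only [h, mul_smul_comm, ← Finset.smul_sum, hy, smul_zero]

/-- Puiseux series, that is, elements of `⋃_{q ≥ 1} K((x ^ (1/q)))`: Hahn series with rational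
exponents having a common denominator. (The support of a Hahn series is well-ordered, hence the
exponents are then also bounded from below.) -/
def IsPuiseux {K : Type*} [Field K] (y : HahnSeries ℚ K) : Prop :=
  ∃ q : ℕ, 1 ≤ q ∧ ∀ e ∈ y.support, ∃ n : ℤ, e = (n : ℚ) / (q : ℚ)

/-- `y` is a Puiseux series solution of `L y = 0`. -/
def IsPuiseuxSolution {K : Type*} [Field K] (b : ℕ) (hb : 2 ≤ b) {r : ℕ}
    (ℓ : Fin (r + 1) → K[X]) (y : HahnSeries ℚ K) : Prop :=
  IsPuiseux y ∧ opHahn b hb ℓ y = 0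

/-! ### The degree bounds -/

/-- The maximal degree `d` of the coefficients of `L`. -/
def opDegree {K : Type*} [Field K] {r : ℕ} (ℓ : Fin (r + 1) → K[X]) : ℕ :=
  Finset.univ.sup fun k => (ℓ k).natDegree

/-- The bound `B_num`, namely `2 d` if `b = 2` and `4 d / b ^ (r - 1)` if `b ≥ 3`. -/
def Bnum (b r d : ℕ) : ℚ :=
  if b = 2 then 2 * (d : ℚ) else 4 * (d : ℚ) / (b : ℚ) ^ ((r : ℤ) - 1)

/-- The bound `B_den`, namely `2 (1 - 1 / 2 ^ r) d` if `b = 2` and `3 d / b ^ (r - 1)` if `b ≥ 3`. -/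
def Bden (b r d : ℕ) : ℚ :=
  if b = 2 then 2 * (1 - 1 / (2 : ℚ) ^ r) * (d : ℚ) else 3 * (d : ℚ) / (b : ℚ) ^ ((r : ℤ) - 1)

/-- `B_∞ = max (B_num, B_den)`, for the operator with coefficients `ℓ`. -/
def Binf {K : Type*} [Field K] (b : ℕ) {r : ℕ} (ℓ : Fin (r + 1) → K[X]) : ℚ :=
  max (Bnum b r (opDegree ℓ)) (Bden b r (opDegree ℓ))

/-! ### Approximate syzygies and minimal bases -/

/-- The module `𝒮^[σ]` of approximate syzygies to order `σ` of a tuple `f` of power series: the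
`w ∈ K[x]^m` with `∑ i, w_i f_i = O(x ^ σ)`. For `σ = ⊤` it is the module of exact syzygies. -/
def approxSyz {K : Type*} [Field K] {m : ℕ} (f : Fin m → PowerSeries K) (σ : ℕ∞) :
    Submodule K[X] (Fin m → K[X]) where
  carrier := {w | (σ : ℕ∞) ≤ (∑ i, (w i : PowerSeries K) * f i).order}
  zero_mem' := by simp
  add_mem' := by
    intro v w hv hw
    have h : (∑ i, (((v + w) i : K[X]) : PowerSeries K) * f i)
        = (∑ i, (v i : PowerSeries K) * f i) + ∑ i, (w i : PowerSeries K) * f i := by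
      simp [add_mul, Finset.sum_add_distrib]
    simp only [Set.mem_ofPred_eq] at hv hw ⊢
    rw [h]
    exact le_trans (le_min hv hw) (PowerSeries.min_order_le_order_add _ _)
  smul_mem' := by
    intro p w hw
    have h : (∑ i, (((p • w) i : K[X]) : PowerSeries K) * f i)
        = (p : PowerSeries K) * ∑ i, (w i : PowerSeries K) * f i := by
      simp [Finset.mul_sum, mul_assoc]
    simp only [Set.mem_ofPred_eq] at hw ⊢
    rw [h, PowerSeries.order_mul]
    exact le_trans hw le_add_self

/-- The tuple `v` of polynomials has degree at most `B`. -/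
def DegLE {K : Type*} [Field K] {m : ℕ} (B : ℚ) (v : Fin m → K[X]) : Prop :=
  ∀ i, ((v i).natDegree : ℚ) ≤ B

/-- The vectorial truncation `𝒯^[σ] = 𝒮^[σ] ∩ K[x]_{≤ B}^m`, a `K`-vector space. -/
def truncSyz {K : Type*} [Field K] {m : ℕ} (f : Fin m → PowerSeries K) (B : ℚ) (hB : 0 ≤ B)
    (σ : ℕ∞) : Submodule K (Fin m → K[X]) where
  carrier := {w | w ∈ approxSyz f σ ∧ DegLE B w}
  zero_mem' := ⟨zero_mem _, fun i => by simpa using hB⟩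
  add_mem' := by
    rintro v w ⟨hv, hv'⟩ ⟨hw, hw'⟩
    refine ⟨add_mem hv hw, fun i => ?_⟩
    have h : (((v + w) i).natDegree : ℚ) ≤ ((max (v i).natDegree (w i).natDegree : ℕ) : ℚ) := by
      exact_mod_cast Polynomial.natDegree_add_le (v i) (w i)
    refine h.trans ?_
    rw [Nat.cast_max]
    exact max_le (hv' i) (hw' i)
  smul_mem' := by
    rintro c w ⟨hw, hw'⟩
    refine ⟨?_, fun i => ?_⟩
    · have h := (approxSyz f σ).smul_mem (Polynomial.C c) hw
      have e : (Polynomial.C c) • w = c • w := by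
        ext1 i
        simp [Polynomial.smul_eq_C_mul]
      rwa [e] at h
    · have h : (((c • w) i).natDegree : ℚ) ≤ ((w i).natDegree : ℚ) := by
        exact_mod_cast Polynomial.natDegree_smul_le c (w i)
      exact h.trans (hw' i)

theorem Binf_nonneg {K : Type*} [Field K] (b : ℕ) {r : ℕ} (ℓ : Fin (r + 1) → K[X]) :
    0 ≤ Binf b ℓ := by
  refine le_max_of_le_left ?_
  unfold Bnum
  split_ifs <;> positivity

/-- The rank of the `K[x]`-module spanned by a set of `m`-tuples of polynomials. -/
def spanRank {K : Type*} [Field K] {m : ℕ} (T : Submodule K (Fin m → K[X])) : ℕ :=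
  Module.finrank K[X] (Submodule.span K[X] (T : Set (Fin m → K[X])))

/-- A basis `w_1, …, w_m` of a submodule of `K[x]^m` is minimal if, for each `i`, the tuple
`w_i = (p_1, …, p_m)` satisfies `deg p_j ≤ deg p_i > deg p_{j'}` whenever `j ≤ i < j'`. -/
def IsMinimalBasis {K : Type*} [Field K] {m : ℕ} {S : Submodule K[X] (Fin m → K[X])}
    (w : Module.Basis (Fin m) K[X] S) : Prop :=
  ∀ i : Fin m,
    (∀ j, j ≤ i → ((w i : Fin m → K[X]) j).degree ≤ ((w i : Fin m → K[X]) i).degree) ∧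
    (∀ j, i < j → ((w i : Fin m → K[X]) j).degree < ((w i : Fin m → K[X]) i).degree)

/-! ### The generating matrix, the augmented generating matrix and its minors -/

open Classical in
/-- The indices of those rows of a family of tuples that have degree at most `B`. -/
def lowRows {K : Type*} [Field K] {m n : ℕ} (B : ℚ) (w : Fin n → Fin m → K[X]) : Finset (Fin n) :=
  Finset.univ.filter fun i => DegLE B (w i)

/-- The generating matrix `W`: the rows of degree at most `B`, in their order. -/
def genMatrix {K : Type*} [Field K] {m n : ℕ} (B : ℚ) (w : Fin n → Fin m → K[X]) :
    Matrix (Fin (lowRows B w).card) (Fin m) K[X] :=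
  Matrix.of fun k => w ((lowRows B w).orderEmbOfFin rfl k)

/-- For a matrix `W` over `K[x]` with `2 N` columns, the augmented matrix `W_a`, obtained by adding
at the bottom of `W` the rows `(a, 0)` and `(0, a)`, where `a = (a_1, …, a_N)` are indeterminates.
The entries are in `K[a_1, …, a_N][x]`. -/
def augMatrix {K : Type*} [Field K] {N ρ : ℕ} (W : Matrix (Fin ρ) (Fin (N + N)) K[X]) :
    Matrix (Fin (ρ + 2)) (Fin (N + N)) (MvPolynomial (Fin N) K)[X] :=
  Matrix.of (Fin.append
    (fun i j => (W i j).map (MvPolynomial.C : K →+* MvPolynomial (Fin N) K))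
    ![Fin.append (fun i => Polynomial.C (MvPolynomial.X i)) (fun _ => 0),
      Fin.append (fun _ => 0) (fun i => Polynomial.C (MvPolynomial.X i))])

/-- The system `Σ`: the coefficients with respect to `x` of the minors of order `ρ + 2` of the
augmented matrix `W_a` (its maximal minors, as soon as `ρ + 2 ≤ 2 N`). -/
def minorSystem {K : Type*} [Field K] {N ρ : ℕ} (W : Matrix (Fin ρ) (Fin (N + N)) K[X]) :
    Set (MvPolynomial (Fin N) K) :=
  {g | ∃ (c : Fin (ρ + 2) ↪o Fin (N + N)) (m : ℕ),
    g = (((augMatrix W).submatrix id c).det).coeff m}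

/-- The tuple `(z_1, …, z_N, M z_1, …, M z_N)`. -/
def seriesTuple {K : Type*} [Field K] (b : ℕ) (hb : 2 ≤ b) {N : ℕ} (z : Fin N → PowerSeries K) :
    Fin (N + N) → PowerSeries K :=
  Fin.append z (fun i => mahlerPS K b hb (z i))

end

end Mahler

/-!
The radical of an ideal is determined by its zero locus, and a linear subspace is the zero locus of
a prime ideal generated by linear forms. It is therefore enough to see that the zero locus of `Σ` is
a finite union of linear subspaces.

At a point `a`, the minors all vanish exactly when some `(u a, v a)` with `(u, v) ≠ (0, 0)` lies in
the span of the rows of `W`, and then `u y + v M y = 0` for `y = ∑ i, a_i z_i`, because `𝒯^[σ]`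
consists of exact syzygies. So `M y = (p / q) y` for some polynomials `p` and `q`. Conversely, let
`M y = (p / q) y` in lowest terms. Then `p / q` solves a Riccati equation, which bounds the degrees
of `p` and `q`, and the predictable degree property of minimal bases puts the syzygy `(-p a, q a)`
in the span of the rows of `W`.

Solutions `y` with `M y ∈ K(x) y` which are not rational multiples of one another are linearly
independent over `K(x)`, as distinct characters are. Hence they fall into finitely many classes, and
each class, completed by `0`, is a `K`-vector space.
-/

namespace Mahler

noncomputable section

section LinearSubspaces

variable {K ι : Type*} [Field K]

theorem aeval_bind₁_toMvPolynomial {R m n : Type*} [CommRing R] [Fintype n]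
    (M : Matrix m n R) (p : MvPolynomial m R) (a : n → R) :
    MvPolynomial.aeval a (MvPolynomial.bind₁ M.toMvPolynomial p) =
      MvPolynomial.aeval (M.mulVec a) p := by
  have hM : (fun i => MvPolynomial.aeval a (M.toMvPolynomial i)) = M.mulVec a :=
    funext fun i => by
      rw [MvPolynomial.aeval_eq_eval]
      exact M.toMvPolynomial_eval_eq_apply i a
  rw [MvPolynomial.aeval_bind₁, hM]

theorem vanishingIdeal_range_mulVecLin [Infinite K] [Fintype ι] {κ : Type*} (M : Matrix κ ι K) :
    MvPolynomial.vanishingIdeal K (LinearMap.range M.mulVecLin : Set (κ → K)) =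
      RingHom.ker (MvPolynomial.bind₁ M.toMvPolynomial) := by
  ext p
  rw [MvPolynomial.mem_vanishingIdeal_iff, LinearMap.coe_range, Matrix.coe_mulVecLin,
    Set.forall_mem_range, RingHom.mem_ker]
  simp only [← aeval_bind₁_toMvPolynomial, MvPolynomial.aeval_eq_eval]
  exact ⟨fun h => MvPolynomial.funext fun a => by simpa using h a, fun h a => by rw [h, map_zero]⟩

theorem ker_bind₁_le_of_X_sub_mem {R σ : Type*} [CommRing R] {I : Ideal (MvPolynomial σ R)}
    {f : σ → MvPolynomial σ R} (hf : ∀ i, MvPolynomial.X i - f i ∈ I) :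
    RingHom.ker (MvPolynomial.bind₁ f) ≤ I := by
  have hmk : (Ideal.Quotient.mkₐ R I).comp (MvPolynomial.bind₁ f) = Ideal.Quotient.mkₐ R I :=
    MvPolynomial.algHom_ext fun i => by
      simpa using (Ideal.Quotient.eq.2 (hf i)).symm
  intro p hp
  rw [RingHom.mem_ker] at hp
  have hp' := DFunLike.congr_fun hmk p
  rw [AlgHom.comp_apply, hp, map_zero] at hp'
  exact Ideal.Quotient.eq_zero_iff_mem.1 hp'.symm

theorem exists_matrix_isProj [Fintype ι] (U : Submodule K (ι → K)) :
    ∃ M : Matrix ι ι K, LinearMap.IsProj U M.mulVecLin := by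
  classical
  obtain ⟨g, hg⟩ := LinearMap.exists_leftInverse_of_injective U.subtype U.ker_subtype
  refine ⟨LinearMap.toMatrix' (U.subtype ∘ₗ g), ?_⟩
  rw [← Matrix.toLin'_apply', Matrix.toLin'_toMatrix']
  refine ⟨fun a => (g a).2, fun a ha => ?_⟩
  have hga : g a = ⟨a, ha⟩ := DFunLike.congr_fun hg ⟨a, ha⟩
  rw [LinearMap.comp_apply, hga, Submodule.subtype_apply]

theorem isPrime_vanishingIdeal_submodule [Infinite K] [Finite ι] (U : Submodule K (ι → K)) :
    (MvPolynomial.vanishingIdeal K (U : Set (ι → K))).IsPrime := by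
  cases nonempty_fintype ι
  obtain ⟨M, hM⟩ := exists_matrix_isProj U
  rw [← hM.range, vanishingIdeal_range_mulVecLin]
  exact RingHom.ker_isPrime _

theorem vanishingIdeal_submodule_eq_span [Infinite K] [Finite ι] (U : Submodule K (ι → K)) :
    MvPolynomial.vanishingIdeal K (U : Set (ι → K)) =
      Ideal.span {g | g.IsHomogeneous 1 ∧ g ∈ MvPolynomial.vanishingIdeal K (U : Set (ι → K))} := by
  cases nonempty_fintype ι
  refine le_antisymm ?_ (Ideal.span_le.2 fun g hg => hg.2)
  obtain ⟨M, hM⟩ := exists_matrix_isProj U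
  conv_lhs => rw [← hM.range, vanishingIdeal_range_mulVecLin]
  refine ker_bind₁_le_of_X_sub_mem fun i => Ideal.subset_span ⟨?_, ?_⟩
  · exact (MvPolynomial.isHomogeneous_X K i).sub (M.toMvPolynomial_isHomogeneous i)
  · intro a ha
    rw [map_sub, MvPolynomial.aeval_X, MvPolynomial.aeval_eq_eval]
    change _ - MvPolynomial.eval a (M.toMvPolynomial i) = 0
    rw [M.toMvPolynomial_eval_eq_apply, ← Matrix.mulVecLin_apply, hM.map_id a ha, sub_self]

theorem exists_linear_primes_of_zeroLocus_eq_iUnion [IsAlgClosed K] [Finite ι]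
    {I : Ideal (MvPolynomial ι K)} {κ : Type*} [Finite κ] {U : κ → Submodule K (ι → K)}
    (h : MvPolynomial.zeroLocus K I = ⋃ k, (U k : Set (ι → K))) :
    ∃ P : Finset (Ideal (MvPolynomial ι K)), I.radical = P.inf id ∧
      ∀ p ∈ P, p.IsPrime ∧
        ∃ G : Set (MvPolynomial ι K), (∀ g ∈ G, g.IsHomogeneous 1) ∧ p = Ideal.span G := by
  classical
  have : Infinite K := IsAlgClosed.instInfinite
  cases nonempty_fintype κ
  refine ⟨Finset.univ.image fun k => MvPolynomial.vanishingIdeal K (U k : Set (ι → K)), ?_, ?_⟩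
  · rw [← MvPolynomial.vanishingIdeal_zeroLocus_eq_radical (K := K), h]
    ext p
    simp only [Finset.inf_image, Submodule.mem_finsetInf, MvPolynomial.mem_vanishingIdeal_iff,
      Set.mem_iUnion, Function.comp, id, Finset.mem_univ, true_imp_iff]
    exact ⟨fun h i x hx => h x ⟨i, hx⟩, fun h x ⟨i, hx⟩ => h i x hx⟩
  · intro p hp
    obtain ⟨k, -, rfl⟩ := Finset.mem_image.1 hp
    exact ⟨isPrime_vanishingIdeal_submodule (U k), _, fun g hg => hg.1,
      vanishingIdeal_submodule_eq_span (U k)⟩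

end LinearSubspaces

section Minors

variable {m n : ℕ}

theorem exists_minor_ne_zero_of_field {F : Type*} [Field F] {A : Matrix (Fin m) (Fin n) F}
    (h : LinearIndependent F A.row) : ∃ c : Fin m ↪o Fin n, (A.submatrix id c).det ≠ 0 := by
  classical
  obtain ⟨κ, a, ha, hspan, hli⟩ := exists_linearIndependent' F A.col
  have : Finite κ := Finite.of_injective a ha
  cases nonempty_fintype κ
  have hcard : (Finset.univ.image a).card = m := by
    have hrank := h.rank_matrix
    rw [A.rank_eq_finrank_span_cols, ← hspan, finrank_span_eq_card hli, Fintype.card_fin] at hrank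
    rwa [Finset.card_image_of_injective _ ha, Finset.card_univ]
  let c : Fin m ↪o Fin n := (Finset.univ.image a).orderEmbOfFin hcard
  have hrange : Set.range c = Set.range a := by simp [c]
  have hc : LinearIndependent F (A.submatrix id c).col := by
    rw [← linearIndepOn_range_iff ha, ← hrange, linearIndepOn_range_iff c.injective] at hli
    exact hli
  rw [Matrix.linearIndependent_cols_iff_isUnit, Matrix.isUnit_iff_isUnit_det] at hc
  exact ⟨c, hc.ne_zero⟩

theorem linearIndependent_row_iff_exists_minor_ne_zero {R : Type*} [CommRing R] [IsDomain R]
    {A : Matrix (Fin m) (Fin n) R} :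
    LinearIndependent R A.row ↔ ∃ c : Fin m ↪o Fin n, (A.submatrix id c).det ≠ 0 := by
  constructor
  · intro h
    let φ : (Fin n → R) →ₗ[R] (Fin n → FractionRing R) :=
      (Algebra.linearMap R (FractionRing R)).compLeft (Fin n)
    have hφ : Function.Injective φ := fun x y hxy =>
      funext fun i => IsFractionRing.injective R (FractionRing R) (congrFun hxy i)
    have hF : LinearIndependent (FractionRing R) (A.map (algebraMap R (FractionRing R))).row :=
      (LinearIndependent.iff_fractionRing R _).1 (h.map_injOn φ hφ.injOn)
    obtain ⟨c, hc⟩ := exists_minor_ne_zero_of_field hF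
    rw [Matrix.submatrix_map, ← RingHom.mapMatrix_apply, ← RingHom.map_det] at hc
    exact ⟨c, ne_zero_of_map hc⟩
  · rintro ⟨c, hc⟩
    have hminor : LinearIndependent R (LinearMap.funLeft R R c ∘ A.row) :=
      Matrix.linearIndependent_rows_of_det_ne_zero hc
    exact hminor.of_comp _

end Minors

section RationalMultiples

variable {R V : Type*} [CommRing R] [IsDomain R] [AddCommGroup V] [Module R V]

variable (R) in
/-- The elements of `V` that are multiples of `y` by elements of the fraction field of `R`, that is,
the saturation of the submodule `R ∙ y`. -/
def rationalMultiples (y : V) : Submodule R V where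
  carrier := {s | ∃ p q : R, q ≠ 0 ∧ q • s = p • y}
  zero_mem' := ⟨0, 1, one_ne_zero, by simp⟩
  add_mem' := by
    rintro s t ⟨p, q, hq, hs⟩ ⟨p', q', hq', ht⟩
    refine ⟨q' * p + q * p', q * q', mul_ne_zero hq hq', ?_⟩
    linear_combination (norm := module) q' • hs + q • ht
  smul_mem' := by
    rintro c s ⟨p, q, hq, hs⟩
    exact ⟨c * p, q, hq, by linear_combination (norm := module) c • hs⟩

theorem self_mem_rationalMultiples (y : V) : y ∈ rationalMultiples R y :=
  ⟨1, 1, one_ne_zero, rfl⟩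

theorem rationalMultiples_le {s y : V} (h : s ∈ rationalMultiples R y) :
    rationalMultiples R s ≤ rationalMultiples R y := by
  obtain ⟨p, q, hq, hs⟩ := h
  rintro t ⟨p', q', hq', ht⟩
  refine ⟨p' * p, q * q', mul_ne_zero hq hq', ?_⟩
  linear_combination (norm := module) q • ht + p' • hs

theorem rationalMultiples_eq [Module.IsTorsionFree R V] {s y : V} (h : s ∈ rationalMultiples R y)
    (hs : s ≠ 0) : rationalMultiples R s = rationalMultiples R y := by
  refine (rationalMultiples_le h).antisymm (rationalMultiples_le ?_)
  obtain ⟨p, q, hq, hsy⟩ := h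
  refine ⟨q, p, ?_, hsy.symm⟩
  rintro rfl
  rw [zero_smul] at hsy
  exact smul_ne_zero hq hs hsy

theorem rationalMultiples_smul [Module.IsTorsionFree R V] {c : R} (hc : c ≠ 0) {y : V}
    (hy : y ≠ 0) : rationalMultiples R (c • y) = rationalMultiples R y :=
  rationalMultiples_eq (Submodule.smul_mem _ c (self_mem_rationalMultiples y)) (smul_ne_zero hc hy)

theorem map_mem_rationalMultiples {τ : R →+* R} (hτ : Function.Injective τ) (σ : V →ₛₗ[τ] V)
    {s y : V} (h : s ∈ rationalMultiples R y) : σ s ∈ rationalMultiples R (σ y) := by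
  obtain ⟨p, q, hq, hs⟩ := h
  refine ⟨τ p, τ q, (map_ne_zero_iff τ hτ).2 hq, ?_⟩
  rw [← map_smulₛₗ, hs, map_smulₛₗ]

theorem exists_common_denominator {ι : Type*} {x y : ι → V}
    (h : ∀ i, x i ∈ rationalMultiples R (y i)) (S : Finset ι) :
    ∃ D : R, D ≠ 0 ∧ ∀ i ∈ S, ∃ P : R, D • x i = P • y i := by
  classical
  choose p q hq hpq using h
  refine ⟨∏ i ∈ S, q i, Finset.prod_ne_zero_iff.2 fun i _ => hq i, fun i hi =>
    ⟨(∏ k ∈ S.erase i, q k) * p i, ?_⟩⟩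
  rw [← Finset.prod_erase_mul _ _ hi, mul_smul, mul_smul, hpq]

theorem exists_isCoprime_of_mem_rationalMultiples [IsPrincipalIdealRing R]
    [Module.IsTorsionFree R V] {s y : V} (h : s ∈ rationalMultiples R y) :
    ∃ p q : R, q ≠ 0 ∧ IsCoprime p q ∧ q • s = p • y := by
  obtain ⟨p, q, hq, h⟩ := h
  obtain ⟨p, q, g, hpq, rfl, rfl⟩ := UniqueFactorizationMonoid.exists_reduced_factors' p q hq
  rw [mul_smul, mul_smul] at h
  exact ⟨p, q, right_ne_zero_of_mul hq, hpq.isCoprime,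
    smul_right_injective V (left_ne_zero_of_mul hq) h⟩

end RationalMultiples

section Hypergeometric

variable {R : Type*} [CommRing R] {τ : R →+* R}

theorem sum_map_mul_smul_eq_zero {V ι : Type*} [AddCommGroup V] [Module R V] {σ : V →ₛₗ[τ] V}
    {S : Finset ι} {y : ι → V} {c P : ι → R} {D : R}
    (hP : ∀ i ∈ S, D • σ (y i) = P i • y i) (hc : ∑ i ∈ S, c i • y i = 0) :
    ∑ i ∈ S, (τ (c i) * P i) • y i = 0 := by
  have hσ := congrArg (D • σ ·) hc
  simp only [map_sum, map_smulₛₗ, map_zero, smul_zero, Finset.smul_sum] at hσ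
  rw [← hσ]
  refine Finset.sum_congr rfl fun i hi => ?_
  rw [mul_smul, ← hP i hi, smul_comm]

variable [IsDomain R]

/-- An element `y` is hypergeometric for a semilinear endomorphism `σ` if `σ y` is a multiple of `y`
by an element of the fraction field of `R`. In particular `0` is hypergeometric. -/
def IsHypergeometric {V : Type*} [AddCommGroup V] [Module R V] (σ : V →ₛₗ[τ] V) (y : V) : Prop :=
  σ y ∈ rationalMultiples R y

section Module

variable {V : Type*} [AddCommGroup V] [Module R V] {σ : V →ₛₗ[τ] V}

theorem IsHypergeometric.zero : IsHypergeometric σ 0 := by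
  rw [IsHypergeometric, map_zero]
  exact zero_mem _

theorem IsHypergeometric.of_smul_add_smul_eq_zero [Module.IsTorsionFree R V] {u v : R} {y : V}
    (huv : u ≠ 0 ∨ v ≠ 0) (h : u • y + v • σ y = 0) : IsHypergeometric σ y := by
  by_cases hv : v = 0
  · rw [hv, zero_smul, add_zero, smul_eq_zero] at h
    rw [h.resolve_left (huv.resolve_right (not_not.2 hv))]
    exact .zero
  · exact ⟨-u, v, hv, by linear_combination (norm := module) h⟩

theorem IsHypergeometric.of_mem [Module.IsTorsionFree R V] (hτ : Function.Injective τ) {s y : V}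
    (hy : IsHypergeometric σ y) (hs : s ∈ rationalMultiples R y) : IsHypergeometric σ s := by
  by_cases hs0 : s = 0
  · exact hs0 ▸ .zero
  · rw [IsHypergeometric, rationalMultiples_eq hs hs0]
    exact rationalMultiples_le hy (map_mem_rationalMultiples hτ σ hs)

theorem isHypergeometric_iff_exists_mem [Module.IsTorsionFree R V] (hτ : Function.Injective τ)
    {S : Set V} {y : V} (hy : y ∈ S) :
    IsHypergeometric σ y ↔
      ∃ E ∈ rationalMultiples R '' {y | y ∈ S ∧ IsHypergeometric σ y}, y ∈ E := by
  constructor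
  · exact fun hyp => ⟨_, ⟨y, ⟨hy, hyp⟩, rfl⟩, self_mem_rationalMultiples y⟩
  · rintro ⟨_, ⟨t, ⟨-, ht⟩, rfl⟩, hyt⟩
    exact ht.of_mem hτ hyt

end Module

section Algebra

variable {A : Type*} [CommRing A] [Algebra R A] [Module.IsTorsionFree R A] {σ : A →ₛₗ[τ] A}

theorem map_smul_mul_smul_comm {x y : A} {c d P Q D : R} (hD : D ≠ 0) (hx : D • σ x = P • x)
    (hy : D • σ y = Q • y) (h : τ d * Q * c = d * (τ c * P)) :
    σ (c • x) * (d • y) = σ (d • y) * (c • x) := by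
  refine smul_right_injective A hD ?_
  rw [map_smulₛₗ, map_smulₛₗ]
  simp only [Algebra.smul_def] at hx hy ⊢
  have hA := congrArg (algebraMap R A) h
  simp only [map_mul] at hA
  linear_combination algebraMap R A (τ c) * algebraMap R A d * y * hx
    - algebraMap R A (τ d) * algebraMap R A c * x * hy - x * y * hA

/- The shortest relation argument for the independence of characters: combining a relation
with its image under `σ` eliminates one term. -/
theorem linearIndependent_of_isHypergeometric
    (hconst : ∀ s t : A, t ≠ 0 → σ s * t = σ t * s → s ∈ rationalMultiples R t)
    {ι : Type*} {y : ι → A} (hy : ∀ i, y i ≠ 0) (hyp : ∀ i, IsHypergeometric σ (y i))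
    (hinj : Function.Injective fun i => rationalMultiples R (y i)) : LinearIndependent R y := by
  classical
  rw [linearIndependent_iff']
  intro S
  induction S using Finset.induction_on with
  | empty => simp
  | insert j S hj ih =>
    intro c hc
    rw [Finset.forall_mem_insert]
    suffices hS : ∀ i ∈ S, c i = 0 by
      rw [Finset.sum_insert hj, Finset.sum_eq_zero fun i hi => by rw [hS i hi, zero_smul],
        add_zero] at hc
      exact ⟨(smul_eq_zero.1 hc).resolve_right (hy j), hS⟩
    by_contra! hne
    obtain ⟨i, hi, hci⟩ := hne
    have hcj : c j ≠ 0 := fun h0 => hci (ih c (by simpa [hj, h0] using hc) i hi)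
    obtain ⟨D, hD, hP⟩ := exists_common_denominator hyp (insert j S)
    choose! P hP using hP
    have hc' := sum_map_mul_smul_eq_zero hP hc
    have hrel : τ (c j) * P j * c i = c j * (τ (c i) * P i) := by
      refine sub_eq_zero.1 (ih (fun k => τ (c j) * P j * c k - c j * (τ (c k) * P k)) ?_ i hi)
      rw [Finset.sum_insert hj] at hc hc'
      simp only [sub_smul, mul_smul _ (c _), mul_smul (c j), Finset.sum_sub_distrib,
        ← Finset.smul_sum]
      linear_combination (norm := module) (τ (c j) * P j) • hc - c j • hc'
    have hmem : c i • y i ∈ rationalMultiples R (c j • y j) :=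
      hconst _ _ (smul_ne_zero hcj (hy j)) <| map_smul_mul_smul_comm hD
        (hP i (Finset.mem_insert_of_mem hi)) (hP j (Finset.mem_insert_self j S)) hrel
    have hEq := rationalMultiples_eq hmem (smul_ne_zero hci (hy i))
    rw [rationalMultiples_smul hci (hy i), rationalMultiples_smul hcj (hy j)] at hEq
    exact hj (hinj hEq ▸ hi)

theorem finite_rationalMultiples_image {K : Type*} [Field K] [Algebra K R] [Module K A]
    [IsScalarTower K R A]
    (hconst : ∀ s t : A, t ≠ 0 → σ s * t = σ t * s → s ∈ rationalMultiples R t)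
    (S : Submodule K A) [Module.Finite K S] :
    (rationalMultiples R '' {y | y ∈ S ∧ IsHypergeometric σ y}).Finite := by
  set E := rationalMultiples R '' {y | (y ∈ S ∧ IsHypergeometric σ y) ∧ y ≠ 0}
  have hE : E.Finite := by
    choose y hy hyE using fun e : E => e.2
    have hinj : Function.Injective fun e => rationalMultiples R (y e) := fun e e' h => by
      simpa only [hyE, Subtype.coe_inj] using h
    have hli := linearIndependent_of_isHypergeometric hconst (fun e => (hy e).2)
      (fun e => (hy e).1.2) hinj
    have hliS : LinearIndependent K fun e => (⟨y e, (hy e).1.1⟩ : S) :=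
      .of_comp S.subtype (hli.restrict_scalars' K)
    exact hliS.finite
  refine (hE.insert (rationalMultiples R 0)).subset ?_
  rintro _ ⟨y, hy, rfl⟩
  by_cases hy0 : y = 0
  · exact .inl (hy0 ▸ rfl)
  · exact .inr ⟨y, ⟨hy, hy0⟩, rfl⟩

end Algebra

end Hypergeometric

section MahlerOperator

variable {K : Type*} [Field K] {b : ℕ} {hb : 2 ≤ b}

theorem algebraMap_powerSeries_eq_coe (p : K[X]) : algebraMap K[X] (PowerSeries K) p = p := by
  rw [PowerSeries.algebraMap_apply', Algebra.algebraMap_self, PowerSeries.map_id, id]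

theorem polynomial_smul_eq_coe_mul (p : K[X]) (y : PowerSeries K) :
    p • y = (p : PowerSeries K) * y := by
  rw [Algebra.smul_def, algebraMap_powerSeries_eq_coe]

instance isTorsionFree_powerSeries : Module.IsTorsionFree K[X] (PowerSeries K) :=
  Module.isTorsionFree_iff_algebraMap_injective.2 fun p q h => by
    simpa only [algebraMap_powerSeries_eq_coe, coe_inj] using h

theorem mahlerPS_coe (p : K[X]) :
    mahlerPS K b hb (p : PowerSeries K) = (expand K b p : K[X]) := by
  ext n
  change PowerSeries.coeff n (PowerSeries.expand b _ (p : PowerSeries K)) = _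
  rw [PowerSeries.coeff_expand, coeff_coe, coeff_coe, coeff_expand (by omega)]

theorem mahlerPS_polynomial_smul (p : K[X]) (y : PowerSeries K) :
    mahlerPS K b hb (p • y) = expand K b p • mahlerPS K b hb y := by
  simp only [polynomial_smul_eq_coe_mul, map_mul, mahlerPS_coe]

theorem mahlerPS_smul (c : K) (y : PowerSeries K) :
    mahlerPS K b hb (c • y) = c • mahlerPS K b hb y :=
  map_smul (PowerSeries.expand b (by omega) : PowerSeries K →ₐ[K] PowerSeries K) c y

theorem order_mahlerPS (y : PowerSeries K) : (mahlerPS K b hb y).order = b • y.order :=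
  PowerSeries.order_expand b (by omega) y

theorem mahlerPS_injective : Function.Injective (mahlerPS K b hb) := by
  refine (injective_iff_map_eq_zero _).2 fun y hy => PowerSeries.ext fun n => ?_
  rw [← PowerSeries.coeff_expand_mul b (by omega) y n]
  exact congrArg (PowerSeries.coeff (b * n)) hy

variable (K b hb) in
/-- The Mahler operator on power series, as a map that is semilinear with respect to the Mahler
operator on polynomials. -/
def mahlerSemilinearMap : PowerSeries K →ₛₗ[(expand K b : K[X] →+* K[X])] PowerSeries K where
  toFun := mahlerPS K b hb
  map_add' := map_add _
  map_smul' := mahlerPS_polynomial_smul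

theorem mahlerSemilinearMap_apply (y : PowerSeries K) :
    mahlerSemilinearMap K b hb y = mahlerPS K b hb y :=
  rfl

theorem eq_zero_of_order_ne_of_mahlerPS_mul_eq {u t : PowerSeries K} (ht : t ≠ 0)
    (hut : mahlerPS K b hb u * t = mahlerPS K b hb t * u) (hord : u.order ≠ t.order) : u = 0 := by
  by_contra hu
  obtain ⟨k, hk⟩ := ENat.ne_top_iff_exists.1 (mt PowerSeries.order_eq_top.1 hu)
  obtain ⟨n, hn⟩ := ENat.ne_top_iff_exists.1 (mt PowerSeries.order_eq_top.1 ht)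
  have h := congrArg PowerSeries.order hut
  simp only [PowerSeries.order_mul, order_mahlerPS, ← hk, ← hn, nsmul_eq_mul] at h
  have hnat : b * k + n = b * n + k := by exact_mod_cast h
  obtain ⟨c, rfl⟩ := Nat.exists_eq_add_of_le' hb
  have hkn : (c + 1) * k = (c + 1) * n := by linarith
  exact hord (by rw [← hk, ← hn, Nat.eq_of_mul_eq_mul_left c.succ_pos hkn])

theorem exists_eq_smul_of_mahlerPS_mul_eq {s t : PowerSeries K} (ht : t ≠ 0)
    (h : mahlerPS K b hb s * t = mahlerPS K b hb t * s) : ∃ c : K, s = c • t := by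
  obtain ⟨n, hn⟩ := ENat.ne_top_iff_exists.1 (mt PowerSeries.order_eq_top.1 ht)
  have hcoeff : PowerSeries.coeff n t ≠ 0 := (PowerSeries.order_eq_nat.1 hn.symm).1
  set c := PowerSeries.coeff n s / PowerSeries.coeff n t with hc
  refine ⟨c, sub_eq_zero.1 (eq_zero_of_order_ne_of_mahlerPS_mul_eq (hb := hb) ht ?_ ?_)⟩
  · rw [map_sub, mahlerPS_smul, sub_mul, h, mul_sub, smul_mul_assoc, mul_smul_comm]
  · intro hord
    refine (PowerSeries.order_eq_nat.1 (hord.trans hn.symm)).1 ?_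
    rw [map_sub, map_smul, smul_eq_mul, hc, div_mul_cancel₀ _ hcoeff, sub_self]

theorem finite_rationalMultiples_mahlerPS (S : Submodule K (PowerSeries K)) [Module.Finite K S] :
    (rationalMultiples K[X] ''
      {y | y ∈ S ∧ IsHypergeometric (mahlerSemilinearMap K b hb) y}).Finite := by
  refine finite_rationalMultiples_image (fun s t ht hst => ?_) S
  obtain ⟨c, rfl⟩ := exists_eq_smul_of_mahlerPS_mul_eq (hb := hb) ht hst
  rw [← algebraMap_smul K[X] c t]
  exact Submodule.smul_mem _ _ (self_mem_rationalMultiples t)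

end MahlerOperator

section RiccatiEquation

variable {K : Type*} [Field K] {b : ℕ} {r : ℕ}

variable (b) in
/-- The numerator of the Riccati polynomial of `L = ∑ k, ℓ_k M ^ k`, evaluated at `p / q`: writing
`u = p / q`, it is `∑ k, ℓ_k · u · M u ⋯ M ^ (k - 1) u` multiplied by `q · M q ⋯ M ^ (r - 1) q`. -/
def riccatiNumerator (ℓ : Fin (r + 1) → K[X]) (p q : K[X]) : K[X] :=
  ∑ k : Fin (r + 1), ℓ k *
    ((∏ j ∈ Finset.range k, expand K (b ^ j) p) * ∏ j ∈ Finset.Ico (k : ℕ) r, expand K (b ^ j) q)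

section Solutions

variable {hb : 2 ≤ b}

theorem iterate_mahlerPS_polynomial_smul (p : K[X]) (y : PowerSeries K) (k : ℕ) :
    (⇑(mahlerPS K b hb))^[k] (p • y) = expand K (b ^ k) p • (⇑(mahlerPS K b hb))^[k] y := by
  induction k with
  | zero => simp
  | succ k ih =>
    rw [Function.iterate_succ_apply', ih, mahlerPS_polynomial_smul, expand_expand,
      ← pow_succ', ← Function.iterate_succ_apply' (⇑(mahlerPS K b hb))]

theorem prod_smul_iterate_mahlerPS {y : PowerSeries K} {p q : K[X]}
    (h : q • mahlerPS K b hb y = p • y) (k : ℕ) :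
    (∏ j ∈ Finset.range k, expand K (b ^ j) q) • (⇑(mahlerPS K b hb))^[k] y =
      (∏ j ∈ Finset.range k, expand K (b ^ j) p) • y := by
  induction k with
  | zero => simp
  | succ k ih =>
    have hk := congrArg (⇑(mahlerPS K b hb))^[k] h
    rw [iterate_mahlerPS_polynomial_smul, iterate_mahlerPS_polynomial_smul,
      ← Function.iterate_succ_apply] at hk
    rw [Finset.prod_range_succ, Finset.prod_range_succ]
    linear_combination (norm := module) (∏ j ∈ Finset.range k, expand K (b ^ j) q) • hk
      + expand K (b ^ k) p • ih

theorem opPS_eq_sum_smul (ℓ : Fin (r + 1) → K[X]) (y : PowerSeries K) :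
    opPS b hb ℓ y = ∑ k, ℓ k • (⇑(mahlerPS K b hb))^[(k : ℕ)] y := by
  simp only [polynomial_smul_eq_coe_mul]
  rfl

theorem riccatiNumerator_smul (ℓ : Fin (r + 1) → K[X]) {y : PowerSeries K} {p q : K[X]}
    (h : q • mahlerPS K b hb y = p • y) :
    riccatiNumerator b ℓ p q • y =
      (∏ j ∈ Finset.range r, expand K (b ^ j) q) • opPS b hb ℓ y := by
  rw [opPS_eq_sum_smul, riccatiNumerator, Finset.sum_smul, Finset.smul_sum]
  refine Finset.sum_congr rfl fun k _ => ?_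
  rw [← Finset.prod_range_mul_prod_Ico (fun j => expand K (b ^ j) q) (Nat.le_of_lt_succ k.2)]
  linear_combination (norm := module)
    -(ℓ k * ∏ j ∈ Finset.Ico (k : ℕ) r, expand K (b ^ j) q) • prod_smul_iterate_mahlerPS h k

theorem riccatiNumerator_eq_zero {ℓ : Fin (r + 1) → K[X]} {y : PowerSeries K} (hy0 : y ≠ 0)
    (hy : opPS b hb ℓ y = 0) {p q : K[X]} (h : q • mahlerPS K b hb y = p • y) :
    riccatiNumerator b ℓ p q = 0 := by
  have hsmul := riccatiNumerator_smul ℓ h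
  rw [hy, smul_zero] at hsmul
  exact (smul_eq_zero.1 hsmul).resolve_right hy0

end Solutions

section Degrees

variable {s : ℕ} {ℓ : Fin (s + 1 + 1) → K[X]} {p q : K[X]}

theorem riccatiNumerator_succ (ℓ : Fin (s + 1 + 1) → K[X]) (p q : K[X]) :
    riccatiNumerator b ℓ p q = ∑ k : Fin (s + 1), ℓ k.castSucc *
        ((∏ j ∈ Finset.range k, expand K (b ^ j) p) *
          ((∏ j ∈ Finset.Ico (k : ℕ) s, expand K (b ^ j) q) * expand K (b ^ s) q)) +
      ℓ (Fin.last (s + 1)) * ((∏ j ∈ Finset.range s, expand K (b ^ j) p) * expand K (b ^ s) p) := by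
  rw [riccatiNumerator, Fin.sum_univ_castSucc]
  congr 1
  · refine Finset.sum_congr rfl fun k _ => ?_
    rw [Fin.val_castSucc, Finset.prod_Ico_succ_top (Nat.le_of_lt_succ k.2)]
  · rw [Fin.val_last, Finset.Ico_self, Finset.prod_empty, mul_one, Finset.prod_range_succ]

theorem natDegree_prod_expand (hb : b ≠ 0) (hp : p ≠ 0) (S : Finset ℕ) :
    (∏ j ∈ S, expand K (b ^ j) p).natDegree = p.natDegree * ∑ j ∈ S, b ^ j := by
  rw [natDegree_prod _ _ fun j _ => (expand_ne_zero (pow_pos (by omega) j)).2 hp, Finset.mul_sum]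
  simp only [natDegree_expand]

theorem natDegree_le_opDegree (ℓ : Fin (r + 1) → K[X]) (k : Fin (r + 1)) :
    (ℓ k).natDegree ≤ opDegree ℓ :=
  Finset.le_sup (f := fun k => (ℓ k).natDegree) (Finset.mem_univ k)

/- The coefficient `ℓ_r` comes with the largest power of `M p`, so cancellation forces the degrees
of `p` and `q` to be close. -/
theorem natDegree_mul_pow_le_of_natDegree_le (hb : b ≠ 0) (hlead : ℓ (Fin.last (s + 1)) ≠ 0)
    (hp : p ≠ 0) (hq : q ≠ 0) (h : riccatiNumerator b ℓ p q = 0)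
    (hle : q.natDegree ≤ p.natDegree) :
    p.natDegree * b ^ s ≤ opDegree ℓ + q.natDegree * b ^ s := by
  rw [riccatiNumerator_succ] at h
  have hdeg := congrArg natDegree (eq_neg_of_add_eq_zero_right h)
  have hexp : ∀ j, expand K (b ^ j) p ≠ 0 := fun j => (expand_ne_zero (by positivity)).2 hp
  have hP := Finset.prod_ne_zero_iff.2 fun j (_ : j ∈ Finset.range s) => hexp j
  rw [natDegree_neg, natDegree_mul hlead (mul_ne_zero hP (hexp s)), natDegree_mul hP (hexp s),
    natDegree_prod_expand hb hp, natDegree_expand] at hdeg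
  have hsum : (∑ k : Fin (s + 1), ℓ k.castSucc * ((∏ j ∈ Finset.range k, expand K (b ^ j) p) *
      ((∏ j ∈ Finset.Ico (k : ℕ) s, expand K (b ^ j) q) * expand K (b ^ s) q))).natDegree ≤
      opDegree ℓ + (p.natDegree * ∑ j ∈ Finset.range s, b ^ j + q.natDegree * b ^ s) := by
    refine natDegree_sum_le_of_forall_le _ _ fun k _ => ?_
    refine natDegree_mul_le_of_le (natDegree_le_opDegree ℓ _) ?_
    rw [← Finset.sum_range_add_sum_Ico _ (Nat.le_of_lt_succ k.2), mul_add, add_assoc]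
    refine natDegree_mul_le_of_le (natDegree_prod_expand hb hp _).le
      (natDegree_mul_le_of_le ?_ (natDegree_expand _ _).le)
    rw [natDegree_prod_expand hb hq]
    exact Nat.mul_le_mul_right _ hle
  omega

/- Every term but the last is divisible by `M ^ s q`, which is coprime to `M ^ s p`. -/
theorem natDegree_mul_pow_le_of_isCoprime (hb : b ≠ 0) (hlead : ℓ (Fin.last (s + 1)) ≠ 0)
    (hp : p ≠ 0) (hpq : IsCoprime p q) (h : riccatiNumerator b ℓ p q = 0) :
    q.natDegree * b ^ s ≤ opDegree ℓ + p.natDegree * ∑ j ∈ Finset.range s, b ^ j := by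
  rw [riccatiNumerator_succ] at h
  have hlast : expand K (b ^ s) q ∣ ℓ (Fin.last (s + 1)) *
      ((∏ j ∈ Finset.range s, expand K (b ^ j) p) * expand K (b ^ s) p) := by
    refine (dvd_add_right (Finset.dvd_sum fun k _ => ?_)).1 (h ▸ dvd_zero _)
    exact ((dvd_mul_left _ _).mul_left _).mul_left _
  have hcop : IsCoprime (expand K (b ^ s) q) (expand K (b ^ s) p) :=
    hpq.symm.map (expand K (b ^ s)).toRingHom
  rw [← mul_assoc] at hlast
  have hP : (∏ j ∈ Finset.range s, expand K (b ^ j) p) ≠ 0 :=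
    Finset.prod_ne_zero_iff.2 fun j _ => (expand_ne_zero (by positivity)).2 hp
  have hdeg := natDegree_le_of_dvd (hcop.dvd_of_dvd_mul_right hlast) (mul_ne_zero hlead hP)
  rw [natDegree_mul hlead hP, natDegree_prod_expand hb hp, natDegree_expand] at hdeg
  exact hdeg.trans (Nat.add_le_add_right (natDegree_le_opDegree ℓ _) _)

theorem max_natDegree_mul_pow_le (hb : b ≠ 0) (hlead : ℓ (Fin.last (s + 1)) ≠ 0)
    (hp : p ≠ 0) (hq : q ≠ 0) (hpq : IsCoprime p q) (h : riccatiNumerator b ℓ p q = 0) :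
    max p.natDegree q.natDegree * b ^ s ≤
      2 * opDegree ℓ + max p.natDegree q.natDegree * ∑ j ∈ Finset.range s, b ^ j := by
  have hcop := natDegree_mul_pow_le_of_isCoprime hb hlead hp hpq h
  rcases le_total q.natDegree p.natDegree with hle | hle
  · have := natDegree_mul_pow_le_of_natDegree_le hb hlead hp hq h hle
    rw [max_eq_left hle]
    omega
  · have := Nat.mul_le_mul_right (∑ j ∈ Finset.range s, b ^ j) hle
    rw [max_eq_right hle]
    omega

theorem le_Bnum_of_mul_pow_le (hb : 2 ≤ b) {d n : ℕ}
    (h : n * b ^ s ≤ 2 * d + n * ∑ j ∈ Finset.range s, b ^ j) : (n : ℚ) ≤ Bnum b (s + 1) d := by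
  obtain ⟨c, rfl⟩ := Nat.exists_eq_add_of_le' hb
  have hgeom : (∑ j ∈ Finset.range s, (c + 2) ^ j) * (c + 1) + 1 = (c + 2) ^ s :=
    geom_sum_mul_add (c + 1) s
  have hpos : 0 < (c + 2) ^ s := by positivity
  generalize ∑ j ∈ Finset.range s, (c + 2) ^ j = e at h hgeom
  rw [Bnum]
  split_ifs with hc
  · obtain rfl : c = 0 := by omega
    rw [← hgeom] at h
    exact_mod_cast (by linarith : n ≤ 2 * d)
  · rw [Nat.cast_succ s, add_sub_cancel_right, zpow_natCast, le_div_iff₀ (by positivity)]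
    have he : 2 * e ≤ (c + 2) ^ s := by nlinarith [Nat.pos_of_ne_zero (by omega : c ≠ 0)]
    have hn := Nat.mul_le_mul_left n he
    exact_mod_cast (by linarith : n * (c + 2) ^ s ≤ 4 * d)

end Degrees

theorem Bnum_nonneg (b r d : ℕ) : 0 ≤ Bnum b r d := by
  unfold Bnum
  split_ifs <;> positivity

theorem natDegree_le_Bnum_of_riccatiNumerator_eq_zero (hb : 2 ≤ b) {ℓ : Fin (r + 1) → K[X]}
    (hlead : ℓ (Fin.last r) ≠ 0) {p q : K[X]} (hp : p ≠ 0) (hq : q ≠ 0) (hpq : IsCoprime p q)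
    (h : riccatiNumerator b ℓ p q = 0) :
    (p.natDegree : ℚ) ≤ Bnum b r (opDegree ℓ) ∧ (q.natDegree : ℚ) ≤ Bnum b r (opDegree ℓ) := by
  cases r with
  | zero => exact absurd (by simpa [riccatiNumerator] using h) hlead
  | succ s =>
    have hmax := le_Bnum_of_mul_pow_le hb
      (max_natDegree_mul_pow_le (by omega) hlead hp hq hpq h)
    rwa [Nat.cast_max, max_le_iff] at hmax

theorem IsHypergeometric.exists_natDegree_le {hb : 2 ≤ b} {ℓ : Fin (r + 1) → K[X]}
    (hlead : ℓ (Fin.last r) ≠ 0) {y : PowerSeries K} (hy : opPS b hb ℓ y = 0)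
    (hyp : IsHypergeometric (mahlerSemilinearMap K b hb) y) :
    ∃ p q : K[X], q ≠ 0 ∧ q • mahlerPS K b hb y = p • y ∧
      (p.natDegree : ℚ) ≤ Bnum b r (opDegree ℓ) ∧ (q.natDegree : ℚ) ≤ Bnum b r (opDegree ℓ) := by
  by_cases hy0 : y = 0
  · have hB := Bnum_nonneg b r (opDegree ℓ)
    exact ⟨1, 1, one_ne_zero, by rw [hy0, map_zero], by simpa using hB, by simpa using hB⟩
  · obtain ⟨p, q, hq, hpq, h⟩ := exists_isCoprime_of_mem_rationalMultiples hyp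
    have hMy : mahlerPS K b hb y ≠ 0 := (map_ne_zero_iff _ mahlerPS_injective).2 hy0
    have hp : p ≠ 0 := by
      rintro rfl
      rw [zero_smul] at h
      exact smul_ne_zero hq hMy h
    exact ⟨p, q, hq, h, natDegree_le_Bnum_of_riccatiNumerator_eq_zero hb hlead hp hq hpq
      (riccatiNumerator_eq_zero hy0 hy h)⟩

end RiccatiEquation

section MinimalBasis

variable {K : Type*} [Field K] {m : ℕ} {S : Submodule K[X] (Fin m → K[X])}
  {w : Module.Basis (Fin m) K[X] S}

theorem coe_eq_sum_repr_smul (w : Module.Basis (Fin m) K[X] S) (t : S) :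
    (t : Fin m → K[X]) = ∑ k, w.repr t k • (w k : Fin m → K[X]) := by
  simpa only [map_sum, map_smul, Submodule.subtype_apply] using
    congrArg S.subtype (w.sum_repr t).symm

theorem IsMinimalBasis.degree_le_degree_diag (hw : IsMinimalBasis w) (i j : Fin m) :
    ((w i : Fin m → K[X]) j).degree ≤ ((w i : Fin m → K[X]) i).degree := by
  rcases le_or_gt j i with h | h
  · exact (hw i).1 j h
  · exact ((hw i).2 j h).le

theorem degree_sum_lt {R ι : Type*} [Semiring R] {S : Finset ι} {f : ι → R[X]} {n : WithBot ℕ}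
    (hn : n ≠ ⊥) (h : ∀ i ∈ S, (f i).degree < n) : (∑ i ∈ S, f i).degree < n :=
  (degree_sum_le S f).trans_lt ((Finset.sup_lt_iff hn.bot_lt).2 h)

/- The predictable degree property. Among the indices `k` for which `c k • w k` has maximal degree,
the last one, `J`, is the only one that contributes to the leading term of the entry `J`. -/
theorem IsMinimalBasis.exists_degree_mul_diag_le (hw : IsMinimalBasis w) (c : Fin m → K[X])
    (i : Fin m) : ∃ J, (c i).degree + ((w i : Fin m → K[X]) i).degree ≤
      (∑ k, c k * (w k : Fin m → K[X]) J).degree := by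
  set F : Fin m → WithBot ℕ := fun k => (c k).degree + ((w k : Fin m → K[X]) k).degree
  have : Nonempty (Fin m) := ⟨i⟩
  obtain ⟨J, hJ⟩ := Finite.exists_max fun k => toLex (F k, k)
  simp only [Prod.Lex.toLex_le_toLex] at hJ
  have hmax : ∀ k, F k ≤ F J := fun k => (hJ k).elim le_of_lt fun h => h.1.le
  refine ⟨J, (hmax i).trans ?_⟩
  by_cases hFJ : F J = ⊥
  · rw [hFJ]
    exact bot_le
  have hlt : ∀ k ∈ Finset.univ.erase J, (c k * (w k : Fin m → K[X]) J).degree < F J := by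
    intro k hk
    rcases hJ k with h | ⟨heq, hle⟩
    · refine lt_of_le_of_lt ?_ h
      rw [degree_mul]
      exact add_le_add le_rfl (hw.degree_le_degree_diag k J)
    · have hck : (c k).degree ≠ ⊥ := fun h =>
        hFJ (heq ▸ WithBot.add_eq_bot.2 (.inl h))
      rw [← heq, degree_mul]
      exact WithBot.add_lt_add_left hck ((hw k).2 J (hle.lt_of_ne (Finset.ne_of_mem_erase hk)))
  rw [← Finset.add_sum_erase _ _ (Finset.mem_univ J),
    degree_add_eq_left_of_degree_lt (degree_mul (p := c J) ▸ degree_sum_lt hFJ hlt), degree_mul]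

theorem IsMinimalBasis.degLE_of_repr_ne_zero (hw : IsMinimalBasis w) {B : ℚ} {t : S}
    (ht : DegLE B (t : Fin m → K[X])) {i : Fin m} (hi : w.repr t i ≠ 0) :
    DegLE B (w i : Fin m → K[X]) := by
  obtain ⟨J, hJ⟩ := hw.exists_degree_mul_diag_le (w.repr t) i
  have htJ : (t : Fin m → K[X]) J = ∑ k, w.repr t k * (w k : Fin m → K[X]) J := by
    conv_lhs => rw [coe_eq_sum_repr_smul w t]
    simp only [Finset.sum_apply, Pi.smul_apply, smul_eq_mul]
  rw [← htJ] at hJ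
  refine fun j => le_trans ?_ (ht J)
  have hdeg : ((w i : Fin m → K[X]) j).degree ≤ ((t : Fin m → K[X]) J).degree :=
    (hw.degree_le_degree_diag i j).trans <|
      (le_add_of_nonneg_left (zero_le_degree_iff.2 hi)).trans hJ
  exact_mod_cast natDegree_le_natDegree hdeg

theorem linearIndependent_genMatrix (w : Module.Basis (Fin m) K[X] S) (B : ℚ) :
    LinearIndependent K[X] (genMatrix B fun i => (w i : Fin m → K[X])).row :=
  (w.linearIndependent.map' S.subtype S.ker_subtype).comp _
    ((lowRows B fun i => (w i : Fin m → K[X])).orderEmbOfFin rfl).injective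

theorem mem_lowRows {n : ℕ} {B : ℚ} {w : Fin n → Fin m → K[X]} {i : Fin n} :
    i ∈ lowRows B w ↔ DegLE B (w i) := by
  simp only [lowRows, Finset.mem_filter_univ]

theorem range_row_genMatrix {n : ℕ} (B : ℚ) (w : Fin n → Fin m → K[X]) :
    Set.range (genMatrix B w).row = w '' {i | DegLE B (w i)} := by
  have h : (genMatrix B w).row = w ∘ (lowRows B w).orderEmbOfFin rfl := rfl
  rw [h, Set.range_comp, Finset.range_orderEmbOfFin]
  congr 1
  ext i
  exact mem_lowRows

theorem IsMinimalBasis.mem_span_genMatrix (hw : IsMinimalBasis w) {B : ℚ} {t : Fin m → K[X]}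
    (htS : t ∈ S) (ht : DegLE B t) :
    t ∈ Submodule.span K[X] (Set.range (genMatrix B fun i => (w i : Fin m → K[X])).row) := by
  rw [range_row_genMatrix, show t = _ from coe_eq_sum_repr_smul w ⟨t, htS⟩]
  refine Submodule.sum_mem _ fun i _ => ?_
  by_cases hi : w.repr ⟨t, htS⟩ i = 0
  · rw [hi, zero_smul]
    exact zero_mem _
  · exact Submodule.smul_mem _ _
      (Submodule.subset_span ⟨i, hw.degLE_of_repr_ne_zero (t := ⟨t, htS⟩) ht hi, rfl⟩)

end MinimalBasis

section AugmentedMatrix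

theorem linearIndependent_append_pair_iff {R V : Type*} [Ring R] [AddCommGroup V] [Module R V]
    {ρ : ℕ} {W : Fin ρ → V} (hW : LinearIndependent R W) {x y : V} :
    LinearIndependent R (Fin.append W ![x, y]) ↔
      ∀ u v : R, u • x + v • y ∈ Submodule.span R (Set.range W) → u = 0 ∧ v = 0 := by
  have hl : (Fin.append W ![x, y] ∘ finSumFinEquiv) ∘ Sum.inl = W :=
    funext fun i => Fin.append_left _ _ i
  have hr : (Fin.append W ![x, y] ∘ finSumFinEquiv) ∘ Sum.inr = ![x, y] :=
    funext fun i => Fin.append_right _ _ i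
  rw [← linearIndependent_equiv finSumFinEquiv, linearIndependent_sum, hl, hr,
    LinearIndependent.pair_iff, Matrix.range_cons_cons_empty, Submodule.disjoint_def]
  constructor
  · rintro ⟨-, hxy, hdisj⟩ u v huv
    exact hxy u v (hdisj _ huv (Submodule.mem_span_pair.2 ⟨u, v, rfl⟩))
  · refine fun h => ⟨hW, fun u v huv => h u v (huv ▸ zero_mem _), fun t ht hxy => ?_⟩
    obtain ⟨u, v, rfl⟩ := Submodule.mem_span_pair.1 hxy
    obtain ⟨rfl, rfl⟩ := h u v ht
    rw [zero_smul, zero_smul, add_zero]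

variable {K : Type*} [Field K] {N ρ : ℕ}

/-- The tuple `(u a_1, …, u a_N, v a_1, …, v a_N)`. -/
def pairTuple (u v : K[X]) (a : Fin N → K) : Fin (N + N) → K[X] :=
  Fin.append (fun i => u * C (a i)) (fun i => v * C (a i))

theorem smul_pairTuple_add_smul_pairTuple (u v : K[X]) (a : Fin N → K) :
    u • pairTuple 1 0 a + v • pairTuple 0 1 a = pairTuple u v a := by
  ext1 j
  refine Fin.addCases (fun j => ?_) (fun j => ?_) j <;> simp [pairTuple, -Fin.natAdd_eq_addNat]

theorem degLE_pairTuple {B : ℚ} {u v : K[X]} (hu : (u.natDegree : ℚ) ≤ B)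
    (hv : (v.natDegree : ℚ) ≤ B) (a : Fin N → K) : DegLE B (pairTuple u v a) := by
  intro j
  refine Fin.addCases (fun j => ?_) (fun j => ?_) j
  · rw [pairTuple, Fin.append_left]
    exact le_trans (by exact_mod_cast natDegree_mul_C_le u _) hu
  · rw [pairTuple, Fin.append_right]
    exact le_trans (by exact_mod_cast natDegree_mul_C_le v _) hv

/-- The specialization of the augmented matrix `W_a` at a point `a ∈ K ^ N`. -/
def augMatrixAt (W : Matrix (Fin ρ) (Fin (N + N)) K[X]) (a : Fin N → K) :
    Matrix (Fin (ρ + 2)) (Fin (N + N)) K[X] :=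
  Matrix.of (Fin.append W.row ![pairTuple 1 0 a, pairTuple 0 1 a])

theorem map_augMatrix (W : Matrix (Fin ρ) (Fin (N + N)) K[X]) (a : Fin N → K) :
    (augMatrix W).map (mapRingHom (MvPolynomial.aeval a : MvPolynomial (Fin N) K →ₐ[K] K)) =
      augMatrixAt W a := by
  ext1 i j
  rw [Matrix.map_apply, augMatrix, augMatrixAt, Matrix.of_apply, Matrix.of_apply, coe_mapRingHom]
  refine Fin.addCases (fun i => ?_) (fun i => ?_) i
  · rw [Fin.append_left, Fin.append_left, Matrix.row_apply, Polynomial.map_map,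
      ← MvPolynomial.algebraMap_eq, AlgHom.comp_algebraMap, Algebra.algebraMap_self,
      Polynomial.map_id]
  · rw [Fin.append_right, Fin.append_right]
    fin_cases i <;> refine Fin.addCases (fun j => ?_) (fun j => ?_) j <;>
      simp [pairTuple, -Fin.natAdd_eq_addNat]

theorem aeval_coeff_minor_augMatrix (W : Matrix (Fin ρ) (Fin (N + N)) K[X]) (a : Fin N → K)
    (c : Fin (ρ + 2) ↪o Fin (N + N)) (n : ℕ) :
    MvPolynomial.aeval a ((((augMatrix W).submatrix id c).det).coeff n) =
      (((augMatrixAt W a).submatrix id c).det).coeff n := by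
  rw [← map_augMatrix, Matrix.submatrix_map, ← RingHom.mapMatrix_apply, ← RingHom.map_det,
    coe_mapRingHom, coeff_map, RingHom.coe_coe]

theorem mem_zeroLocus_minorSystem_iff {W : Matrix (Fin ρ) (Fin (N + N)) K[X]} {a : Fin N → K} :
    a ∈ MvPolynomial.zeroLocus K (Ideal.span (minorSystem W)) ↔
      ¬ LinearIndependent K[X] (augMatrixAt W a).row := by
  rw [linearIndependent_row_iff_exists_minor_ne_zero, MvPolynomial.zeroLocus_span]
  simp only [not_exists, not_not, Polynomial.ext_iff, coeff_zero, ← aeval_coeff_minor_augMatrix]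
  constructor
  · exact fun ha c n => ha _ ⟨c, n, rfl⟩
  · rintro ha _ ⟨c, n, rfl⟩
    exact ha c n

theorem mem_zeroLocus_minorSystem_iff_exists {W : Matrix (Fin ρ) (Fin (N + N)) K[X]}
    (hW : LinearIndependent K[X] W.row) {a : Fin N → K} :
    a ∈ MvPolynomial.zeroLocus K (Ideal.span (minorSystem W)) ↔
      ∃ u v : K[X], (u ≠ 0 ∨ v ≠ 0) ∧
        pairTuple u v a ∈ Submodule.span K[X] (Set.range W.row) := by
  have h := linearIndependent_append_pair_iff hW (x := pairTuple 1 0 a) (y := pairTuple 0 1 a)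
  simp only [smul_pairTuple_add_smul_pairTuple] at h
  rw [mem_zeroLocus_minorSystem_iff, show LinearIndependent K[X] (augMatrixAt W a).row ↔ _ from h]
  push Not
  simp only [and_comm, ne_eq, imp_iff_not_or]

end AugmentedMatrix

section Syzygies

variable {K : Type*} [Field K]

theorem approxSyz_anti {m : ℕ} {f : Fin m → PowerSeries K} {σ τ : ℕ∞} (h : σ ≤ τ) :
    approxSyz f τ ≤ approxSyz f σ :=
  fun _ hv => h.trans hv

theorem mem_approxSyz_top {m : ℕ} {f : Fin m → PowerSeries K} {v : Fin m → K[X]} :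
    v ∈ approxSyz f ⊤ ↔ ∑ i, v i • f i = 0 := by
  simp only [polynomial_smul_eq_coe_mul]
  exact top_le_iff.trans PowerSeries.order_eq_top

variable {b : ℕ} {hb : 2 ≤ b} {N : ℕ} {z : Fin N → PowerSeries K} {a : Fin N → K}

theorem sum_pairTuple_smul_seriesTuple (u v : K[X]) :
    ∑ i, pairTuple u v a i • seriesTuple b hb z i =
      u • Fintype.linearCombination K z a +
        v • mahlerSemilinearMap K b hb (Fintype.linearCombination K z a) := by
  rw [Fintype.linearCombination_apply, mahlerSemilinearMap_apply, map_sum, Fin.sum_univ_add]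
  have hC : ∀ (c : K) (y : PowerSeries K), C c • y = c • y := algebraMap_smul K[X]
  simp only [pairTuple, seriesTuple, Fin.append_left, Fin.append_right, mahlerPS_smul,
    Finset.smul_sum, mul_smul, hC]

theorem pairTuple_mem_approxSyz_top_iff {u v : K[X]} :
    pairTuple u v a ∈ approxSyz (seriesTuple b hb z) ⊤ ↔
      u • Fintype.linearCombination K z a +
        v • mahlerSemilinearMap K b hb (Fintype.linearCombination K z a) = 0 := by
  rw [mem_approxSyz_top, sum_pairTuple_smul_seriesTuple]

variable {r : ℕ} {ℓ : Fin (r + 1) → K[X]} {B : ℚ} {σ : ℕ∞}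
  {w : Module.Basis (Fin (N + N)) K[X] (approxSyz (seriesTuple b hb z) σ)}

theorem span_genMatrix_le_approxSyz_top
    (hσ : ∀ v ∈ approxSyz (seriesTuple b hb z) σ, DegLE B v →
      v ∈ approxSyz (seriesTuple b hb z) ⊤) :
    Submodule.span K[X] (Set.range (genMatrix B fun i => (w i : Fin (N + N) → K[X])).row) ≤
      approxSyz (seriesTuple b hb z) ⊤ := by
  rw [range_row_genMatrix, Submodule.span_le]
  rintro _ ⟨i, hi, rfl⟩
  exact hσ _ (w i).2 hi

theorem mem_zeroLocus_minorSystem_genMatrix_iff (hlead : ℓ (Fin.last r) ≠ 0)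
    (hz : ∀ i, z i ∈ seriesSolutions b hb ℓ) (hB : Bnum b r (opDegree ℓ) ≤ B)
    (hσ : ∀ v ∈ approxSyz (seriesTuple b hb z) σ, DegLE B v →
      v ∈ approxSyz (seriesTuple b hb z) ⊤) (hw : IsMinimalBasis w) :
    a ∈ MvPolynomial.zeroLocus K (Ideal.span (minorSystem
        (genMatrix B fun i => (w i : Fin (N + N) → K[X])))) ↔
      IsHypergeometric (mahlerSemilinearMap K b hb) (Fintype.linearCombination K z a) := by
  rw [mem_zeroLocus_minorSystem_iff_exists (linearIndependent_genMatrix w B)]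
  constructor
  · rintro ⟨u, v, huv, hmem⟩
    exact .of_smul_add_smul_eq_zero huv
      (pairTuple_mem_approxSyz_top_iff.1 (span_genMatrix_le_approxSyz_top hσ hmem))
  · intro hyp
    have hsol : Fintype.linearCombination K z a ∈ seriesSolutions b hb ℓ := by
      rw [Fintype.linearCombination_apply]
      exact sum_mem fun i _ => Submodule.smul_mem _ _ (hz i)
    obtain ⟨p, q, hq, hpq, hp_le, hq_le⟩ := hyp.exists_natDegree_le hlead hsol
    refine ⟨-p, q, .inr hq, hw.mem_span_genMatrix (approxSyz_anti le_top ?_) ?_⟩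
    · rw [pairTuple_mem_approxSyz_top_iff, mahlerSemilinearMap_apply, hpq, neg_smul,
        neg_add_cancel]
    · exact degLE_pairTuple (by rw [natDegree_neg]; exact hp_le.trans hB) (hq_le.trans hB) a

end Syzygies

end

end Mahler

open Mahler in
theorem mainTheorem7_general {K : Type*} [Field K] [IsAlgClosed K]
    (b : ℕ) (hb : 2 ≤ b) (r : ℕ) (ℓ : Fin (r + 1) → K[X]) (hlead : ℓ (Fin.last r) ≠ 0)
    (N : ℕ) (z : Fin N → PowerSeries K) (hz : ∀ i, z i ∈ seriesSolutions b hb ℓ)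
    (B : ℚ) (hB : Bnum b r (opDegree ℓ) ≤ B) (σ : ℕ∞)
    (hσ : ∀ v ∈ approxSyz (seriesTuple b hb z) σ, DegLE B v →
      v ∈ approxSyz (seriesTuple b hb z) ⊤)
    (w : Module.Basis (Fin (N + N)) K[X] (approxSyz (seriesTuple b hb z) σ))
    (hw : IsMinimalBasis w) :
    ∃ P : Finset (Ideal (MvPolynomial (Fin N) K)),
      (Ideal.span (minorSystem
        (genMatrix B fun i => (w i : Fin (N + N) → K[X])))).radical = P.inf id ∧
      ∀ p ∈ P, p.IsPrime ∧
        ∃ G : Set (MvPolynomial (Fin N) K), (∀ g ∈ G, g.IsHomogeneous 1) ∧ p = Ideal.span G := by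
  let φ := Fintype.linearCombination K z
  let Λ := rationalMultiples K[X] ''
    {y | y ∈ LinearMap.range φ ∧ IsHypergeometric (mahlerSemilinearMap K b hb) y}
  have : Finite Λ := finite_rationalMultiples_mahlerPS _
  refine exists_linear_primes_of_zeroLocus_eq_iUnion
    (U := fun E : Λ => (E.1.restrictScalars K).comap φ)
    (Set.ext fun a => ?_)
  rw [mem_zeroLocus_minorSystem_genMatrix_iff hlead hz hB hσ hw, isHypergeometric_iff_exists_mem
    (expand_injective (by omega)) (SetLike.mem_coe.2 (LinearMap.mem_range_self φ a))]
  simp [φ, Λ]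

theorem mainTheorem7 {K : Type*} [Field K] [IsAlgClosed K]
    (b : ℕ) (hb : 2 ≤ b) (r : ℕ) (ℓ : Fin (r + 1) → Polynomial K)
    (hlead : ℓ (Fin.last r) ≠ 0) (hzero : ℓ 0 ≠ 0)
    (hprim : ∀ p : Polynomial K, (∀ k, p ∣ ℓ k) → IsUnit p)
    (N : ℕ) (z : Module.Basis (Fin N) K (Mahler.seriesSolutions b hb ℓ))
    (hPuiseux : ∀ y : HahnSeries ℚ K, Mahler.IsPuiseuxSolution b hb ℓ y →
      ∃ s : PowerSeries K, y = HahnSeries.ofPowerSeries ℚ K s)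
    (f : Fin (N + N) → PowerSeries K)
    (hf : f = Mahler.seriesTuple b hb (fun i => (z i : PowerSeries K)))
    (T : ℕ∞ → Submodule K (Fin (N + N) → Polynomial K))
    (hT : T = Mahler.truncSyz f (Mahler.Binf b ℓ) (Mahler.Binf_nonneg b ℓ))
    (σ : ℕ) (hρ_pos : 1 ≤ Mahler.spanRank (T σ)) (hρ_le : Mahler.spanRank (T σ) + 2 ≤ 2 * N)
    (hσ : T σ = T ⊤)
    (w : Module.Basis (Fin (N + N)) (Polynomial K) (Mahler.approxSyz f σ))
    (hw : Mahler.IsMinimalBasis w) :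
    ∃ P : Finset (Ideal (MvPolynomial (Fin N) K)),
      (Ideal.span (Mahler.minorSystem (Mahler.genMatrix (Mahler.Binf b ℓ)
        (fun i => (w i : Fin (N + N) → Polynomial K))))).radical = P.inf id ∧
      ∀ p ∈ P, p.IsPrime ∧
        ∃ G : Set (MvPolynomial (Fin N) K), (∀ g ∈ G, g.IsHomogeneous 1) ∧ p = Ideal.span G := by
  subst hf hT
  refine mainTheorem7_general b hb r ℓ hlead N _ (fun i => (z i).2) _ (le_max_left _ _) σ
    (fun v hv hdeg => ?_) w hw
  exact (hσ.le ⟨hv, hdeg⟩).1
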